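/- Let $\mathcal{M}^2$ be the Euclidean plane $\mathbb{R}^2$, the unit sphere $S^2$ with its geodesic distance, or the hyperbolic plane $H^2$ of curvature $-1$. For $z\in\mathcal{M}^2$ and $r\ge 0$ let $B(z,r)=\{x\in\mathcal{M}^2 : d(x,z)\le r\}$. For a non-empty compact set $K\subseteq\mathcal{M}^2$ let $$r(K)=\max\{r\ge 0 : \exists z\in\mathcal{M}^2,\ B(z,r)\subseteq K\},\qquad R(K)=\min\{R\ge 0 : \exists z\in\mathcal{M}^2,\ K\subseteq B(z,R)\}$$ be its inradius and circumradius. A bounded set $K\subseteq\mathcal{M}^2$ is called complete if $\operatorname{diam}(K\cup\{y\})>\operatorname{diam}(K)$ for every $y\in\mathcal{M}^2\setminus K$. A Reuleaux triangle of diameter $D$ is a set of the form $\bigcap_{i=1}^3 B(v_i,D)$ where $v_1,v_2,v_3\in\mathcal{M}^2$ are the vertices of a regular triangle of side length $D$. Let $D>0$, where $D<\frac{\pi}{2}$ if $\mathcal{M}^2=S^2$. Then Reuleaux triangles of diameter $D$ exist in $\mathcal{M}^2$. If $U_D\subseteq\mathcal{M}^2$ is any of them and $K\subseteq\mathcal{M}^2$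 is a complete set of diameter $D$, then the maxima and minima defining $r(U_D)$, $R(U_D)$, $r(K)$ and $R(K)$ are attained, $$r(U_D)\le r(K)\le R(K)\le R(U_D),$$ and if $r(K)=r(U_D)$ or $R(K)=R(U_D)$, then $K$ is a Reuleaux triangle of diameter $D$. -/

import Mathlib

open Metric

/-- The unit sphere `S²` in Euclidean three-space. It is a type of its own, so that it carries the
geodesic metric below and not the chordal metric of the ambient space. -/
@[ext]
structure UnitSphere where
  /-- the position vector of the point -/
  vec : EuclideanSpace ℝ (Fin 3)
  norm_vec : ‖vec‖ = 1

theorem UnitSphere.vec_ne_zero (x : UnitSphere) : x.vec ≠ 0 := by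
  intro h
  have := x.norm_vec
  simp [h] at this

/-- The geodesic metric on `S²`: the distance of two points is the angle (in `[0, π]`) between
their position vectors, that is, `arccos ⟪x, y⟫`. -/
noncomputable instance : MetricSpace UnitSphere where
  dist x y := InnerProductGeometry.angle x.vec y.vec
  dist_self x := InnerProductGeometry.angle_self x.vec_ne_zero
  dist_comm x y := InnerProductGeometry.angle_comm x.vec y.vec
  dist_triangle x y z := InnerProductGeometry.angle_le_angle_add_angle x.vec y.vec z.vec
  eq_of_dist_eq_zero {x y} h := by
    have h1 : InnerProductGeometry.angle x.vec y.vec = 0 := h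
    have h2 := (InnerProductGeometry.inner_eq_mul_norm_iff_angle_eq_zero
      x.vec_ne_zero y.vec_ne_zero).2 h1
    rw [x.norm_vec, y.norm_vec, one_mul] at h2
    exact UnitSphere.ext ((inner_eq_one_iff_of_norm_eq_one x.norm_vec y.norm_vec).1 h2)

/-- The three model surfaces of constant curvature: `ℝ²`, `S²` and `H²`. -/
inductive ModelSurface where
  | euclidean
  | spherical
  | hyperbolic

/-- The points of a model surface: the Euclidean plane (curvature `0`), the unit sphere with its
geodesic metric (curvature `1`), and the hyperbolic plane, for which we take Mathlib's upper
half-plane with its hyperbolic metric (curvature `-1`). -/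
def ModelSurface.Point : ModelSurface → Type
  | .euclidean => EuclideanSpace ℝ (Fin 2)
  | .spherical => UnitSphere
  | .hyperbolic => UpperHalfPlane

noncomputable instance ModelSurface.instMetricSpacePoint :
    (M : ModelSurface) → MetricSpace M.Point
  | .euclidean => inferInstanceAs (MetricSpace (EuclideanSpace ℝ (Fin 2)))
  | .spherical => inferInstanceAs (MetricSpace UnitSphere)
  | .hyperbolic => inferInstanceAs (MetricSpace UpperHalfPlane)

section MetricNotions

/-- A bounded set is (diametrically) complete if adding any point outside of it makes its
diameter larger. This is unrelated to the convergence of Cauchy sequences. -/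
def IsDiametricallyComplete {X : Type*} [MetricSpace X] (K : Set X) : Prop :=
  Bornology.IsBounded K ∧ ∀ y : X, y ∉ K → diam K < diam (insert y K)

/-- The radii of the closed balls contained in `K`. -/
def inscribedRadii {X : Type*} [MetricSpace X] (K : Set X) : Set ℝ :=
  {r | 0 ≤ r ∧ ∃ z : X, closedBall z r ⊆ K}

/-- The radii of the closed balls containing `K`. -/
def circumscribedRadii {X : Type*} [MetricSpace X] (K : Set X) : Set ℝ :=
  {R | 0 ≤ R ∧ ∃ z : X, K ⊆ closedBall z R}

/-- The inradius `r(K)`. -/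
noncomputable def inradius {X : Type*} [MetricSpace X] (K : Set X) : ℝ :=
  sSup (inscribedRadii K)

/-- The circumradius `R(K)`. -/
noncomputable def circumradius {X : Type*} [MetricSpace X] (K : Set X) : ℝ :=
  sInf (circumscribedRadii K)

/-- `U` is a Reuleaux triangle of diameter `D`: the intersection of the three closed discs of
radius `D` centered at the vertices of a regular triangle of side length `D`. -/
def IsReuleauxTriangle {X : Type*} [MetricSpace X] (D : ℝ) (U : Set X) : Prop :=
  ∃ v : Fin 3 → X, (∀ i j : Fin 3, i ≠ j → dist (v i) (v j) = D) ∧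
    U = ⋂ i : Fin 3, closedBall (v i) D

end MetricNotions

/-! The three geometries are treated at once through one law of cosines: `m` is `t ^ 2 / 2`, `1 -
cos t` or `cosh t - 1`, and `s` is `t`, `sin t` or `sinh t`.

In a complete set `K` of diameter `D`, a disc `B(z, r)` lies in `K` exactly when `K` lies in `B(z, D
- r)` (`mem_inscribedRadii_iff`). Hence `r(K) + R(K) = D`, and only the circumradius has to be
studied.

The upper bound is Jung's theorem (`jung`). At a circumcentre, `0` is a convex combination of the
chart vectors of at most three points of `K` at distance `R`, since otherwise the centre could be
moved to shrink the disc. Expanding the square of this combination with weights `l i` gives `s R ^ 2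
= 2 * ∑ l i * l j * m (d i j)`, summed over pairs, which is at most `2 / 3 * m D`. For a Reuleaux
triangle the reverse bound follows from the three vertices alone (`two_m_le_of_reuleaux_subset`),
and `s ^ 2` is increasing on `[0, D]`.

Equality in Jung's bound forces equal weights and a regular triangle of side `D` in `K`. Then `K`
lies in the Reuleaux triangle on it, and completeness gives equality because that triangle has
diameter at most `D` (`dist_le_of_mem_reuleaux`). -/

/-! ### Convex hulls in the plane -/

/-- Carathéodory's theorem in the plane, with exactly three points. -/
theorem exists_three_of_mem_convexHull {S : Set (EuclideanSpace ℝ (Fin 2))}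
    {x : EuclideanSpace ℝ (Fin 2)} (hx : x ∈ convexHull ℝ S) :
    ∃ (l : Fin 3 → ℝ) (q : Fin 3 → EuclideanSpace ℝ (Fin 2)), l ∈ stdSimplex ℝ (Fin 3) ∧
      (∀ i, q i ∈ S) ∧ ∑ i, l i • q i = x := by
  obtain ⟨s₀, hs₀⟩ : S.Nonempty := convexHull_nonempty_iff.1 ⟨x, hx⟩
  obtain ⟨ι, _, z, w, hz, haff, hw, hsum, hzx⟩ := eq_pos_convex_span_of_mem_convexHull hx
  have hcard : Fintype.card ι ≤ Fintype.card (Fin 3) := by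
    refine haff.card_le_finrank_succ.trans ?_
    have := Submodule.finrank_le (vectorSpan ℝ (Set.range z))
    simp only [finrank_euclideanSpace, Fintype.card_fin] at this ⊢
    omega
  obtain ⟨f⟩ := Function.Embedding.nonempty_of_card_le hcard
  have hzero : ∀ i ∉ Set.range f, Function.extend f w 0 i = 0 := fun i hi =>
    Function.extend_apply' _ _ _ hi
  -- Missing points are filled by an arbitrary `s₀` of `S` with weight zero.
  refine ⟨Function.extend f w 0, Function.extend f z fun _ => s₀, ⟨fun i => ?_, ?_⟩,
    fun i => ?_, ?_⟩
  · by_cases hi : i ∈ Set.range f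
    · obtain ⟨j, rfl⟩ := hi
      simpa [f.injective.extend_apply] using (hw j).le
    · rw [hzero i hi]
  · rw [← hsum]
    refine (Fintype.sum_of_injective f f.injective _ _ hzero fun j => ?_).symm
    rw [f.injective.extend_apply]
  · by_cases hi : i ∈ Set.range f
    · obtain ⟨j, rfl⟩ := hi
      rw [f.injective.extend_apply]
      exact hz ⟨j, rfl⟩
    · rwa [Function.extend_apply' _ _ _ hi]
  · rw [← hzx]
    refine (Fintype.sum_of_injective f f.injective _ _ (fun i hi => ?_) fun j => ?_).symm
    · rw [hzero i hi, zero_smul]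
    · rw [f.injective.extend_apply, f.injective.extend_apply]

theorem IsCompact.convexHull_plane {S : Set (EuclideanSpace ℝ (Fin 2))} (hS : IsCompact S) :
    IsCompact (convexHull ℝ S) := by
  have himage : convexHull ℝ S =
      (fun a : (Fin 3 → ℝ) × (Fin 3 → EuclideanSpace ℝ (Fin 2)) => ∑ i, a.1 i • a.2 i) ''
        (stdSimplex ℝ (Fin 3) ×ˢ Set.univ.pi fun _ => S) := by
    ext x
    constructor
    · intro hx
      obtain ⟨l, q, hl, hq, rfl⟩ := exists_three_of_mem_convexHull hx
      exact ⟨(l, q), ⟨hl, fun i _ => hq i⟩, rfl⟩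
    · rintro ⟨⟨l, q⟩, ⟨hl, hq⟩, rfl⟩
      exact (convex_convexHull ℝ S).sum_mem (fun i _ => hl.1 i) hl.2
        fun i _ => subset_convexHull ℝ S (hq i trivial)
  rw [himage]
  exact ((isCompact_stdSimplex ℝ (Fin 3)).prod (isCompact_univ_pi fun _ => hS)).image
    (by fun_prop)

/-- Strict separation of `0` from the hull, which is closed because `S` is compact. -/
theorem exists_unit_inner_pos {S : Set (EuclideanSpace ℝ (Fin 2))} (hS : IsCompact S)
    (h0 : (0 : EuclideanSpace ℝ (Fin 2)) ∉ convexHull ℝ S) :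
    ∃ w : EuclideanSpace ℝ (Fin 2), ‖w‖ = 1 ∧ ∀ q ∈ S, 0 < inner ℝ q w := by
  rcases S.eq_empty_or_nonempty with rfl | ⟨s₀, hs₀⟩
  · exact ⟨EuclideanSpace.single 0 1, by simp, by simp⟩
  obtain ⟨f, u, hu, hf⟩ := geometric_hahn_banach_point_closed (convex_convexHull ℝ S)
    hS.convexHull_plane.isClosed h0
  rw [map_zero] at hu
  set w := (InnerProductSpace.toDual ℝ (EuclideanSpace ℝ (Fin 2))).symm f with hw
  have hpos : ∀ q ∈ S, 0 < inner ℝ q w := fun q hq => by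
    rw [real_inner_comm, hw, InnerProductSpace.toDual_symm_apply]
    exact hu.trans (hf q (subset_convexHull ℝ S hq))
  have hw0 : w ≠ 0 := by
    intro h
    simpa [h] using hpos s₀ hs₀
  refine ⟨‖w‖⁻¹ • w, norm_smul_inv_norm hw0, fun q hq => ?_⟩
  rw [real_inner_smul_right]
  exact mul_pos (inv_pos.2 (norm_pos_iff.2 hw0)) (hpos q hq)

/-! ### Circumscribed balls and complete sets in metric spaces -/

theorem isLeast_circumradius {X : Type*} [MetricSpace X] [ProperSpace X] {K : Set X}
    (hK : Bornology.IsBounded K) (hne : K.Nonempty) :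
    IsLeast (circumscribedRadii K) (circumradius K) := by
  obtain ⟨x₀, hx₀⟩ := hne
  have hbdd : BddBelow (circumscribedRadii K) := ⟨0, fun r hr => hr.1⟩
  have hnonempty : (circumscribedRadii K).Nonempty := by
    obtain ⟨r, hr⟩ := hK.subset_closedBall x₀
    exact ⟨max r 0, le_max_right _ _, x₀,
      hr.trans (closedBall_subset_closedBall (le_max_left _ _))⟩
  -- Centres belonging to convergent radii stay in a bounded set around `x₀`, so properness yields a
  -- limiting centre.
  have hclosed : IsClosed (circumscribedRadii K) := by
    refine isSeqClosed_iff_isClosed.1 ?_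
    intro r R hr hlim
    choose h0 z hz using hr
    obtain ⟨C, hC⟩ := hlim.bddAbove_range
    have hzmem : ∀ n, z n ∈ closedBall x₀ C := fun n => by
      rw [mem_closedBall, dist_comm]
      exact (hz n hx₀).trans (hC ⟨n, rfl⟩)
    obtain ⟨c, -, φ, hφ, hc⟩ := (isCompact_closedBall x₀ C).tendsto_subseq hzmem
    refine ⟨ge_of_tendsto' hlim h0, c, fun x hx => ?_⟩
    exact le_of_tendsto_of_tendsto' (tendsto_const_nhds.dist hc)
      (hlim.comp hφ.tendsto_atTop) fun n => hz (φ n) hx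
  exact ⟨hclosed.csInf_mem hnonempty hbdd, fun r hr => csInf_le hbdd hr⟩

section Complete

variable {X : Type*} [MetricSpace X] {K : Set X} {D : ℝ}

theorem IsDiametricallyComplete.dist_le (hK : IsDiametricallyComplete K) (hd : diam K = D)
    {x y : X} (hx : x ∈ K) (hy : y ∈ K) : dist x y ≤ D :=
  hd ▸ dist_le_diam_of_mem hK.1 hx hy

theorem IsDiametricallyComplete.mem_of_forall_dist_le (hK : IsDiametricallyComplete K)
    (hd : diam K = D) (hD : 0 ≤ D) {y : X} (hy : ∀ x ∈ K, dist y x ≤ D) : y ∈ K := by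
  by_contra hyK
  refine (hK.2 y hyK).not_ge ?_
  rw [hd]
  refine diam_le_of_forall_dist_le hD ?_
  rintro a (rfl | ha) b (rfl | hb)
  · simpa using hD
  · exact hy b hb
  · rw [dist_comm]
    exact hy a ha
  · exact hK.dist_le hd ha hb

theorem IsDiametricallyComplete.isClosed (hK : IsDiametricallyComplete K) (hd : diam K = D)
    (hD : 0 ≤ D) : IsClosed K := by
  have : K = ⋂ x ∈ K, closedBall x D := by
    refine Set.Subset.antisymm ?_ fun y hy => ?_
    · exact Set.subset_iInter₂ fun x hx y hy => hK.dist_le hd hy hx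
    · exact hK.mem_of_forall_dist_le hd hD fun x hx => Set.mem_iInter₂.1 hy x hx
  rw [this]
  exact isClosed_biInter fun x _ => isClosed_closedBall

theorem nonempty_of_diam_pos (hd : diam K = D) (hD : 0 < D) : K.Nonempty := by
  rw [Set.nonempty_iff_ne_empty]
  rintro rfl
  rw [diam_empty] at hd
  exact hD.ne hd

theorem le_two_mul_of_mem_circumscribedRadii (hd : diam K = D) {R : ℝ}
    (hR : R ∈ circumscribedRadii K) : D ≤ 2 * R := by
  obtain ⟨h0, z, hz⟩ := hR
  rw [← hd]
  exact (diam_mono hz isBounded_closedBall).trans (diam_closedBall h0)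

theorem IsDiametricallyComplete.circumradius_le [ProperSpace X] (hK : IsDiametricallyComplete K)
    (hd : diam K = D) (hD : 0 < D) : circumradius K ≤ D := by
  obtain ⟨x, hx⟩ := nonempty_of_diam_pos hd hD
  exact (isLeast_circumradius hK.1 ⟨x, hx⟩).2
    ⟨hD.le, x, fun y hy => hK.dist_le hd hy hx⟩

end Complete

/-! ### Surfaces with a law of cosines -/

/-- Polar coordinates around `z`: `p` maps the plane to its tangent plane at `z`, a point at
distance `t` from `z` to a vector of length `s t`, in such a way that the law of cosines holds for
triangles with a vertex at `z`. -/
structure IsPolarChart {X : Type*} [MetricSpace X] (κ : ℝ) (m s : ℝ → ℝ) (I : Set ℝ) (z : X)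
    (p : X → EuclideanSpace ℝ (Fin 2)) : Prop where
  law : ∀ x y, m (dist x y) = m (dist z x) + m (dist z y) - κ * m (dist z x) * m (dist z y) -
    inner ℝ (p x) (p y)
  surj : ∀ t ∈ I, ∀ w : EuclideanSpace ℝ (Fin 2), ‖w‖ = 1 → ∃ x, dist z x = t ∧ p x = s t • w

/-- A surface satisfying the law of cosines of constant curvature `κ`, in terms of
`m t = ∫₀ᵗ s` where `s` is the generalized sine. The set `I` is the range of the metric. -/
structure CosineLaw (X : Type*) [MetricSpace X] (κ : ℝ) (m s : ℝ → ℝ) (I : Set ℝ) : Prop where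
  dist_mem : ∀ x y : X, dist x y ∈ I
  strictMonoOn : StrictMonoOn m I
  continuous_m : Continuous m
  continuous_s : Continuous s
  m_zero : m 0 = 0
  s_nonneg : ∀ t ∈ I, 0 ≤ s t
  s_sq : ∀ t, s t ^ 2 = 2 * m t - κ * m t ^ 2
  m_add : ∀ a b, m (a + b) = m a + m b - κ * m a * m b + s a * s b
  exists_chart : ∀ z : X, ∃ p, IsPolarChart κ m s I z p
  nonempty : Nonempty X

namespace CosineLaw

variable {X : Type*} [MetricSpace X] {κ : ℝ} {m s : ℝ → ℝ} {I : Set ℝ} {D : ℝ}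

theorem zero_mem (h : CosineLaw X κ m s I) : 0 ∈ I := by
  obtain ⟨x⟩ := h.nonempty
  simpa using h.dist_mem x x

theorem m_dist_nonneg (h : CosineLaw X κ m s I) (x y : X) : 0 ≤ m (dist x y) := by
  rw [← h.m_zero]
  exact (h.strictMonoOn.le_iff_le h.zero_mem (h.dist_mem x y)).2 dist_nonneg

theorem m_nonneg (h : CosineLaw X κ m s I) {t : ℝ} (ht : t ∈ I) (ht0 : 0 ≤ t) : 0 ≤ m t := by
  rw [← h.m_zero]
  exact (h.strictMonoOn.le_iff_le h.zero_mem ht).2 ht0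

theorem m_pos (h : CosineLaw X κ m s I) {t : ℝ} (ht : t ∈ I) (ht0 : 0 < t) : 0 < m t := by
  rw [← h.m_zero]
  exact h.strictMonoOn h.zero_mem ht ht0

theorem m_dist_le_iff (h : CosineLaw X κ m s I) {t : ℝ} (ht : t ∈ I) {x y : X} :
    m (dist x y) ≤ m t ↔ dist x y ≤ t :=
  h.strictMonoOn.le_iff_le (h.dist_mem x y) ht

theorem m_dist_lt_iff (h : CosineLaw X κ m s I) {t : ℝ} (ht : t ∈ I) {x y : X} :
    m (dist x y) < m t ↔ dist x y < t :=
  h.strictMonoOn.lt_iff_lt (h.dist_mem x y) ht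

theorem dist_eq_of_m_eq (h : CosineLaw X κ m s I) {t : ℝ} (ht : t ∈ I) {x y : X}
    (hm : m (dist x y) = m t) : dist x y = t :=
  h.strictMonoOn.injOn (h.dist_mem x y) ht hm

/-- `1 - κ * m t` is `1`, `cos t` or `cosh t`. For `κ ≤ 0` it is at least `1`; for `κ ≥ 0` it is
smallest at `t = D`. -/
theorem one_sub_pos (h : CosineLaw X κ m s I) (hI : Set.Icc 0 (2 * D) ⊆ I) (hD : 0 < D)
    (hκ : 0 < 1 - κ * m D) {t : ℝ} (ht0 : 0 ≤ t) (ht : t ≤ D) : 0 < 1 - κ * m t := by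
  have htI : t ∈ I := hI ⟨ht0, by linarith⟩
  have h1 := h.m_nonneg htI ht0
  have h2 : m t ≤ m D := (h.strictMonoOn.le_iff_le htI (hI ⟨hD.le, by linarith⟩)).2 ht
  rcases le_total κ 0 with hk | hk
  · nlinarith
  · nlinarith [mul_le_mul_of_nonneg_left h2 hk]

section Chart

variable {z : X} {p : X → EuclideanSpace ℝ (Fin 2)}

theorem norm_sq_chart (h : CosineLaw X κ m s I) (hp : IsPolarChart κ m s I z p) (x : X) :
    ‖p x‖ ^ 2 = 2 * m (dist z x) - κ * m (dist z x) ^ 2 := by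
  have h1 := hp.law x x
  rw [dist_self, h.m_zero, real_inner_self_eq_norm_sq] at h1
  linarith

theorem norm_chart (h : CosineLaw X κ m s I) (hp : IsPolarChart κ m s I z p) (x : X) :
    ‖p x‖ = s (dist z x) := by
  have h1 := h.norm_sq_chart hp x
  rw [← h.s_sq] at h1
  exact (sq_eq_sq₀ (norm_nonneg _) (h.s_nonneg _ (h.dist_mem z x))).1 h1

/-- By the law of cosines, `‖p x - p y‖ ^ 2` is a continuous expression in distances. -/
theorem continuous_chart (h : CosineLaw X κ m s I) (hp : IsPolarChart κ m s I z p) :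
    Continuous p := by
  rw [continuous_iff_continuousAt]
  intro y
  rw [ContinuousAt, tendsto_iff_norm_sub_tendsto_zero]
  set F : X → ℝ := fun x => ‖p y‖ ^ 2 + (2 * m (dist z x) - κ * m (dist z x) ^ 2) -
    2 * (m (dist z x) + m (dist z y) - κ * m (dist z x) * m (dist z y) - m (dist x y)) with hF
  have heq : ∀ x, ‖p x - p y‖ = √(F x) := by
    intro x
    rw [← Real.sqrt_sq (norm_nonneg (p x - p y)), norm_sub_sq_real, h.norm_sq_chart hp x]
    have := hp.law x y
    congr 1
    rw [hF]
    simp only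
    linarith
  have hm := h.continuous_m
  have hcont : Continuous fun x => √(F x) := by
    rw [hF]
    fun_prop
  have h0 : √(F y) = 0 := by
    rw [← heq, sub_self, norm_zero]
  simp_rw [heq]
  simpa [h0] using hcont.tendsto y

end Chart

/-- Prolongs the segment from `x` beyond `z`: leaving `z` in the direction opposite to `p x` turns
the law of cosines into the addition formula for `m`. -/
theorem exists_extension (h : CosineLaw X κ m s I) (x z : X) {t : ℝ} (ht : t ∈ I)
    (hadd : dist z x + t ∈ I) : ∃ y, dist z y = t ∧ dist x y = dist z x + t := by
  obtain ⟨p, hp⟩ := h.exists_chart z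
  obtain ⟨w, hw, hwx⟩ : ∃ w : EuclideanSpace ℝ (Fin 2), ‖w‖ = 1 ∧ inner ℝ (p x) w = -‖p x‖ := by
    by_cases hx : p x = 0
    · exact ⟨EuclideanSpace.single 0 1, by simp, by simp [hx]⟩
    · refine ⟨-(‖p x‖⁻¹ • p x), by rw [norm_neg]; exact norm_smul_inv_norm hx, ?_⟩
      rw [inner_neg_right, real_inner_smul_right, real_inner_self_eq_norm_sq]
      have : ‖p x‖ ≠ 0 := norm_ne_zero_iff.2 hx
      field_simp
  obtain ⟨y, hy, hpy⟩ := hp.surj t ht w hw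
  refine ⟨y, hy, h.dist_eq_of_m_eq hadd ?_⟩
  rw [hp.law, hpy, hy, real_inner_smul_right, hwx, h.norm_chart hp, h.m_add]
  ring

/-! ### Inscribed and circumscribed discs of a complete set -/

theorem mem_inscribedRadii_iff (h : CosineLaw X κ m s I) (hI : Set.Icc 0 (2 * D) ⊆ I)
    (hD : 0 < D) {K : Set X} (hK : IsDiametricallyComplete K) (hd : diam K = D) {r : ℝ}
    (hr0 : 0 ≤ r) : r ∈ inscribedRadii K ↔ D - r ∈ circumscribedRadii K := by
  constructor
  · rintro ⟨-, z, hz⟩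
    have hzK : z ∈ K := hz (mem_closedBall_self hr0)
    have hrD : r ≤ D := by
      by_contra! hlt
      -- Truncating at `2 * D` keeps the length in `I`, while it still exceeds `D`.
      have hmin : min r (2 * D) ∈ I := hI ⟨le_min hr0 (by linarith), min_le_right _ _⟩
      obtain ⟨y, hy, -⟩ := h.exists_extension z z hmin (by simpa using hmin)
      have hyK : y ∈ K := hz (by rw [mem_closedBall, dist_comm, hy]; exact min_le_left _ _)
      have := hK.dist_le hd hzK hyK
      rw [hy, min_le_iff] at this
      rcases this with h1 | h1 <;> linarith
    refine ⟨by linarith, z, fun x hx => ?_⟩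
    have hzx := hK.dist_le hd hzK hx
    have h0 : 0 ≤ dist z x := dist_nonneg
    -- The point `y` of the inscribed disc opposite to `x` satisfies `dist z x + r = dist x y ≤ D`.
    obtain ⟨y, hy, hxy⟩ := h.exists_extension x z (t := r) (hI ⟨hr0, by linarith⟩)
      (hI ⟨by linarith, by linarith⟩)
    have hyK : y ∈ K := hz (by rw [mem_closedBall, dist_comm, hy])
    have := hK.dist_le hd hx hyK
    rw [mem_closedBall, dist_comm]
    linarith
  · rintro ⟨-, z, hz⟩
    refine ⟨hr0, z, fun y hy => hK.mem_of_forall_dist_le hd hD.le fun x hx => ?_⟩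
    have h1 : dist x z ≤ D - r := hz hx
    have h2 : dist y z ≤ r := hy
    linarith [dist_triangle_right y x z]

theorem isGreatest_inscribedRadii [ProperSpace X] (h : CosineLaw X κ m s I)
    (hI : Set.Icc 0 (2 * D) ⊆ I) (hD : 0 < D) {K : Set X} (hK : IsDiametricallyComplete K)
    (hd : diam K = D) : IsGreatest (inscribedRadii K) (D - circumradius K) := by
  have hleast := isLeast_circumradius hK.1 (nonempty_of_diam_pos hd hD)
  refine ⟨?_, fun r hr => ?_⟩
  · rw [h.mem_inscribedRadii_iff hI hD hK hd (by linarith [hK.circumradius_le hd hD])]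
    simpa using hleast.1
  · have := hleast.2 ((h.mem_inscribedRadii_iff hI hD hK hd hr.1).1 hr)
    linarith

theorem inradius_eq [ProperSpace X] (h : CosineLaw X κ m s I)
    (hI : Set.Icc 0 (2 * D) ⊆ I) (hD : 0 < D) {K : Set X} (hK : IsDiametricallyComplete K)
    (hd : diam K = D) : inradius K = D - circumradius K :=
  (h.isGreatest_inscribedRadii hI hD hK hd).csSup_eq

/-! ### The circumcentre -/

/-- Arbitrarily short displacements from `z` have `m t` small compared to `s t`. -/
theorem exists_small (h : CosineLaw X κ m s I) (hI : Set.Icc 0 (2 * D) ⊆ I) (hD : 0 < D)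
    {ε c : ℝ} (hε : 0 < ε) (hc : 0 < c) :
    ∃ t ∈ I, 0 < t ∧ t < ε ∧ 0 < 1 - κ * m t ∧ m t < c * s t := by
  have hm := h.continuous_m
  have hs := h.continuous_s
  have hs0 : s 0 = 0 := by
    have := h.s_sq 0
    rw [h.m_zero] at this
    simpa using this
  have e1 : ∀ᶠ t in nhds (0 : ℝ), 0 < 1 - κ * m t :=
    ((by fun_prop : Continuous fun t => 1 - κ * m t).tendsto 0).eventually_const_lt
      (by simp [h.m_zero])
  have e2 : ∀ᶠ t in nhds (0 : ℝ), s t < c := (hs.tendsto 0).eventually_lt_const (by rwa [hs0])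
  have e3 : ∀ᶠ t in nhds (0 : ℝ), t < min ε (2 * D) :=
    eventually_lt_nhds (lt_min hε (by linarith))
  obtain ⟨t, ⟨ht1, ht2, ht3⟩, ht0⟩ :=
    ((((e1.and (e2.and e3)).filter_mono nhdsWithin_le_nhds).and
      (self_mem_nhdsWithin : Set.Ioi (0 : ℝ) ∈ nhdsWithin 0 (Set.Ioi 0))).exists)
  have ht0 : 0 < t := ht0
  have htI : t ∈ I := hI ⟨ht0.le, (ht3.trans_le (min_le_right _ _)).le⟩
  refine ⟨t, htI, ht0, ht3.trans_le (min_le_left _ _), ht1, ?_⟩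
  have hmt := h.m_pos htI ht0
  have hsq := h.s_sq t
  have hsnn := h.s_nonneg t htI
  -- `s t ^ 2 = m t * (1 + (1 - κ * m t))`; combined with `s t < c` this gives the claim.
  have hlt : m t < s t ^ 2 := by nlinarith
  have hspos : 0 < s t := hsnn.lt_of_ne fun h0 => by
    rw [← h0] at hlt
    norm_num at hlt
    linarith
  nlinarith

/-- Otherwise some direction `w` makes a positive inner product with the chart vectors of all points
at distance `R`. A short move of `z` along `w` brings every point of `K` strictly closer than `R`:
the points well inside the half-plane of `w` by the law of cosines, the others because they had a
margin `ε`. -/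
theorem zero_mem_convexHull_of_least (h : CosineLaw X κ m s I) (hI : Set.Icc 0 (2 * D) ⊆ I)
    (hD : 0 < D) {K : Set X} (hK : IsCompact K) (hne : K.Nonempty) {R : ℝ} (hR0 : 0 < R)
    (hRD : R ≤ D) {z : X} (hz : K ⊆ closedBall z R)
    (hleast : ∀ R' ∈ circumscribedRadii K, R ≤ R') {p : X → EuclideanSpace ℝ (Fin 2)}
    (hp : IsPolarChart κ m s I z p) :
    0 ∈ convexHull ℝ (p '' {x ∈ K | dist z x = R}) := by
  by_contra hcon
  have hpc := h.continuous_chart hp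
  have hfar : IsCompact {x ∈ K | dist z x = R} :=
    hK.inter_right (isClosed_eq (by fun_prop) continuous_const)
  obtain ⟨w, hw, hpos⟩ := exists_unit_inner_pos (hfar.image hpc) hcon
  have hRI : R ∈ I := hI ⟨hR0.le, by linarith⟩
  have hzK : ∀ x ∈ K, dist z x ≤ R := fun x hx => by
    rw [dist_comm]
    exact hz hx
  obtain ⟨δ, hδ, hδfar⟩ : ∃ δ > 0, ∀ x ∈ K, dist z x = R → δ < inner ℝ (p x) w := by
    rcases Set.eq_empty_or_nonempty {x ∈ K | dist z x = R} with he | he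
    · exact ⟨1, one_pos, fun x hx hxR => absurd (show x ∈ {x ∈ K | dist z x = R} from ⟨hx, hxR⟩)
        (by simp [he])⟩
    · obtain ⟨x₀, hx₀, hmin⟩ := hfar.exists_isMinOn he
        (by fun_prop : Continuous fun x => inner ℝ (p x) w).continuousOn
      have h1 := hpos _ ⟨x₀, hx₀, rfl⟩
      exact ⟨inner ℝ (p x₀) w / 2, by linarith, fun x hx hxR => by
        have := isMinOn_iff.1 hmin x ⟨hx, hxR⟩
        linarith⟩
  obtain ⟨ε, hε, hεnear⟩ : ∃ ε > 0, ∀ x ∈ K, inner ℝ (p x) w ≤ δ → dist z x ≤ R - ε := by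
    have hnear : IsCompact {x ∈ K | inner ℝ (p x) w ≤ δ} :=
      hK.inter_right (isClosed_le (by fun_prop : Continuous fun x => inner ℝ (p x) w)
        continuous_const)
    rcases Set.eq_empty_or_nonempty {x ∈ K | inner ℝ (p x) w ≤ δ} with he | he
    · exact ⟨1, one_pos, fun x hx hxR =>
        absurd (show x ∈ {x ∈ K | inner ℝ (p x) w ≤ δ} from ⟨hx, hxR⟩) (by simp [he])⟩
    · obtain ⟨x₀, hx₀, hmax⟩ := hnear.exists_isMaxOn he
        (by fun_prop : Continuous fun x => dist z x).continuousOn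
      have h1 : dist z x₀ < R := (hzK x₀ hx₀.1).lt_of_ne fun heq =>
        (hδfar x₀ hx₀.1 heq).not_ge hx₀.2
      exact ⟨R - dist z x₀, by linarith, fun x hx hxR => by
        have := isMaxOn_iff.1 hmax x ⟨hx, hxR⟩
        linarith⟩
  set C := 1 + |1 - κ * m R| with hC
  have hCpos : 0 < C := by positivity
  obtain ⟨t, htI, ht0, htε, ht1, hmt⟩ := h.exists_small hI hD hε (div_pos hδ hCpos)
  have hmt0 := h.m_pos htI ht0
  have hst := h.s_nonneg t htI
  -- The left side bounds the second-order loss in `m`, the right side the first-order gain from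
  -- moving along `w`.
  have hmC : m t * (1 - κ * m R) < s t * δ := by
    rw [div_mul_eq_mul_div, lt_div_iff₀ hCpos] at hmt
    nlinarith [le_abs_self (1 - κ * m R)]
  obtain ⟨y, hy, hpy⟩ := hp.surj t htI w hw
  have hlt : ∀ x ∈ K, dist y x < R := by
    intro x hx
    rcases le_or_gt (inner ℝ (p x) w) δ with hle | hgt
    · have h1 := hεnear x hx hle
      have h2 := dist_triangle y z x
      rw [dist_comm y z, hy] at h2
      linarith
    · rw [dist_comm, ← h.m_dist_lt_iff hRI, hp.law, hy, hpy, real_inner_smul_right]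
      have h1 := (h.m_dist_le_iff hRI).2 (hzK x hx)
      nlinarith [mul_le_mul_of_nonneg_left hgt.le hst, mul_le_mul_of_nonneg_right h1 ht1.le]
  obtain ⟨x₀, hx₀, hmax⟩ := hK.exists_isMaxOn hne
    (by fun_prop : Continuous fun x => dist y x).continuousOn
  refine (hlt x₀ hx₀).not_ge (hleast _ ⟨dist_nonneg, y, fun x hx => ?_⟩)
  rw [mem_closedBall, dist_comm]
  exact hmax hx

end CosineLaw

/-! ### Algebra for the diameter of a Reuleaux triangle -/

theorem inner_plane (a b : EuclideanSpace ℝ (Fin 2)) :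
    inner ℝ a b = a 0 * b 0 + a 1 * b 1 := by
  rw [PiLp.inner_apply, Fin.sum_univ_two]
  simp [mul_comm]

/-- Four vectors in the plane have a singular `3 × 3` Gram matrix. -/
theorem gram_plane (a b p q : EuclideanSpace ℝ (Fin 2)) :
    inner ℝ p q * (inner ℝ a a * inner ℝ b b - inner ℝ a b ^ 2) =
      inner ℝ p a * (inner ℝ q a * inner ℝ b b - inner ℝ q b * inner ℝ a b) +
        inner ℝ p b * (inner ℝ q b * inner ℝ a a - inner ℝ q a * inner ℝ a b) := by
  simp only [inner_plane]
  ring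

theorem pairwise_dist_eq_of_three {X : Type*} [MetricSpace X] {D : ℝ} {v : Fin 3 → X}
    (h01 : dist (v 0) (v 1) = D) (h02 : dist (v 0) (v 2) = D) (h12 : dist (v 1) (v 2) = D) :
    ∀ i j, i ≠ j → dist (v i) (v j) = D := by
  simp [Fin.forall_fin_succ, dist_comm (v 1) (v 0), dist_comm (v 2) (v 0), dist_comm (v 2) (v 1),
    h01, h02, h12]

/-- With `T = b₀ + b₁ + b₂ - e`, the difference of the sides is `∑ aᵢ * (2 * bᵢ - T) + e * T`. If `2
* b₀ ≤ T`, the other two coefficients are nonnegative and `a₀ ≤ e` leaves at least `2 * e * b₀`. -/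
theorem box_inequality {e a₀ a₁ a₂ b₀ b₁ b₂ : ℝ}
    (ha₀ : 0 ≤ a₀) (ha₁ : 0 ≤ a₁) (ha₂ : 0 ≤ a₂) (hb₀ : 0 ≤ b₀) (hb₁ : 0 ≤ b₁) (hb₂ : 0 ≤ b₂)
    (ha₀e : a₀ ≤ e) (ha₁e : a₁ ≤ e) (ha₂e : a₂ ≤ e)
    (hb₀e : b₀ ≤ e) (hb₁e : b₁ ≤ e) (hb₂e : b₂ ≤ e) (hb : e ≤ b₀ + b₁ + b₂) :
    (a₀ + a₁ + a₂ - e) * (b₀ + b₁ + b₂ - e) ≤ 2 * (a₀ * b₀ + a₁ * b₁ + a₂ * b₂) := by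
  have key : ∀ {x y z u v w : ℝ}, 0 ≤ x → 0 ≤ y → 0 ≤ z → x ≤ e → 0 ≤ u → v ≤ e → w ≤ e →
      2 * u ≤ u + v + w - e →
      (x + y + z - e) * (u + v + w - e) ≤ 2 * (x * u + y * v + z * w) := by
    intro x y z u v w hx hy hz hxe hu hv hw hneg
    have h1 : 0 ≤ y * (2 * v - (u + v + w - e)) := mul_nonneg hy (by linarith)
    have h2 : 0 ≤ z * (2 * w - (u + v + w - e)) := mul_nonneg hz (by linarith)
    have h3 : 0 ≤ (e - x) * ((u + v + w - e) - 2 * u) := mul_nonneg (by linarith) (by linarith)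
    have h4 : 0 ≤ e * u := mul_nonneg (by linarith) hu
    nlinarith
  rcases le_total (2 * b₀) (b₀ + b₁ + b₂ - e) with h0 | h0
  · exact key ha₀ ha₁ ha₂ ha₀e hb₀ hb₁e hb₂e h0
  rcases le_total (2 * b₁) (b₀ + b₁ + b₂ - e) with h1 | h1
  · have := key ha₁ ha₀ ha₂ ha₁e hb₁ hb₀e hb₂e (by linarith)
    linarith
  rcases le_total (2 * b₂) (b₀ + b₁ + b₂ - e) with h2 | h2
  · have := key ha₂ ha₀ ha₁ ha₂e hb₂ hb₀e hb₁e (by linarith)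
    linarith
  have e0 := mul_nonneg ha₀ (sub_nonneg.2 h0)
  have e1 := mul_nonneg ha₁ (sub_nonneg.2 h1)
  have e2 := mul_nonneg ha₂ (sub_nonneg.2 h2)
  have e3 : 0 ≤ e * (b₀ + b₁ + b₂ - e) := mul_nonneg (ha₀.trans ha₀e) (by linarith)
  nlinarith

namespace CosineLaw

variable {X : Type*} [MetricSpace X] {κ : ℝ} {m s : ℝ → ℝ} {I : Set ℝ} {D : ℝ}

/-! ### Reuleaux triangles -/

theorem exists_regular_triangle (h : CosineLaw X κ m s I) (hI : Set.Icc 0 (2 * D) ⊆ I)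
    (hD : 0 < D) (hκ : 0 < 1 - κ * m D) :
    ∃ v : Fin 3 → X, ∀ i j, i ≠ j → dist (v i) (v j) = D := by
  have hDI : D ∈ I := hI ⟨hD.le, by linarith⟩
  have he := h.m_pos hDI hD
  obtain ⟨z⟩ := h.nonempty
  obtain ⟨p, hp⟩ := h.exists_chart z
  set k := 1 - κ * m D with hk
  -- The cosine of the angle of a regular triangle of side `D`, from `s D ^ 2 = m D * (1 + k)`.
  set c := k / (1 + k) with hc
  have hc0 : 0 ≤ c := by positivity
  have hc1 : c ≤ 1 := by
    rw [hc, div_le_one (by linarith)]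
    linarith
  have hroot : √(1 - c ^ 2) ^ 2 = 1 - c ^ 2 := Real.sq_sqrt (by nlinarith)
  obtain ⟨x, hx, hpx⟩ := hp.surj D hDI !₂[1, 0] (by
    simp [EuclideanSpace.norm_eq])
  obtain ⟨y, hy, hpy⟩ := hp.surj D hDI !₂[c, √(1 - c ^ 2)] (by
    rw [EuclideanSpace.norm_eq, Real.sqrt_eq_one, Fin.sum_univ_two]
    simp only [Real.norm_eq_abs, sq_abs]
    change c ^ 2 + √(1 - c ^ 2) ^ 2 = 1
    rw [hroot]
    ring)
  have hxy : dist x y = D := by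
    refine h.dist_eq_of_m_eq hDI ?_
    have hin : inner ℝ (p x) (p y) = s D ^ 2 * c := by
      rw [hpx, hpy, inner_plane]
      simp only [PiLp.smul_apply, smul_eq_mul]
      change s D * 1 * (s D * c) + s D * 0 * (s D * _) = _
      ring
    have hcmul : (1 + k) * c = k := by
      rw [hc]
      field_simp
    rw [hp.law, hx, hy, hin, h.s_sq]
    linear_combination m D * (-hcmul) + (m D - m D * c) * hk
  exact ⟨![z, x, y], pairwise_dist_eq_of_three hx hy hxy⟩

/-- The defects `e - m (dist x (v i))` serve as coordinates of `x`. The planar Gram relation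
expresses `e - m (dist x y)` symmetrically in the defects of `x` and `y`, and `box_inequality` shows
it to be nonnegative. -/
theorem dist_le_of_mem_reuleaux (h : CosineLaw X κ m s I) (hI : Set.Icc 0 (2 * D) ⊆ I)
    (hD : 0 < D) (hκ : 0 < 1 - κ * m D) {v : Fin 3 → X}
    (hv : ∀ i j, i ≠ j → dist (v i) (v j) = D) {x y : X}
    (hx : ∀ i, dist x (v i) ≤ D) (hy : ∀ i, dist y (v i) ≤ D) : dist x y ≤ D := by
  have hDI : D ∈ I := hI ⟨hD.le, by linarith⟩
  have he := h.m_pos hDI hD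
  obtain ⟨p, hp⟩ := h.exists_chart (v 0)
  set e := m D with hedef
  have hnorm : ∀ i, i ≠ 0 → inner ℝ (p (v i)) (p (v i)) = 2 * e - κ * e ^ 2 := fun i hi => by
    rw [real_inner_self_eq_norm_sq, h.norm_sq_chart hp, hv 0 i hi.symm]
  have h12 : inner ℝ (p (v 1)) (p (v 2)) = e - κ * e ^ 2 := by
    have := hp.law (v 1) (v 2)
    rw [hv 0 1 (by decide), hv 0 2 (by decide), hv 1 2 (by decide)] at this
    linarith
  have hinner : ∀ x i, i ≠ 0 → inner ℝ (p x) (p (v i)) =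
      m (dist x (v 0)) + e - κ * m (dist x (v 0)) * e - m (dist x (v i)) := fun x i hi => by
    have := hp.law x (v i)
    rw [hv 0 i hi.symm, dist_comm (v 0) x] at this
    linarith
  have identity : ∀ x y, (3 - 2 * κ * e) * e * (e - m (dist x y)) =
      (3 - 2 * κ * e) * ((e - m (dist x (v 0))) * (e - m (dist y (v 0))) +
        (e - m (dist x (v 1))) * (e - m (dist y (v 1))) +
        (e - m (dist x (v 2))) * (e - m (dist y (v 2)))) -
      (1 - κ * e) * ((e - m (dist x (v 0))) + (e - m (dist x (v 1))) +
          (e - m (dist x (v 2))) - e) *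
        ((e - m (dist y (v 0))) + (e - m (dist y (v 1))) + (e - m (dist y (v 2))) - e) := by
    intro x y
    have hgram := gram_plane (p (v 1)) (p (v 2)) (p x) (p y)
    have hlaw := hp.law x y
    rw [dist_comm (v 0) x, dist_comm (v 0) y] at hlaw
    rw [hnorm 1 (by decide), hnorm 2 (by decide), h12, hinner x 1 (by decide),
      hinner x 2 (by decide), hinner y 1 (by decide), hinner y 2 (by decide)] at hgram
    refine mul_left_cancel₀ he.ne' ?_
    linear_combination hgram - (3 - 2 * κ * e) * e ^ 2 * hlaw
  have hle : ∀ {x}, (∀ i, dist x (v i) ≤ D) → ∀ i, 0 ≤ e - m (dist x (v i)) := fun hx i =>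
    sub_nonneg.2 ((h.m_dist_le_iff hDI).2 (hx i))
  have hub : ∀ x i, e - m (dist x (v i)) ≤ e := fun x i => by
    linarith [h.m_dist_nonneg x (v i)]
  -- The identity with `y = x` gives `e ^ 2 ≤ ∑ aᵢ ^ 2 ≤ (∑ aᵢ) ^ 2` for the defects `aᵢ`.
  have hsum : ∀ {x}, (∀ i, dist x (v i) ≤ D) → e ≤ (e - m (dist x (v 0))) +
      (e - m (dist x (v 1))) + (e - m (dist x (v 2))) := by
    intro x hx
    have hid := identity x x
    rw [dist_self, h.m_zero] at hid
    have h0 := hle hx 0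
    have h1 := hle hx 1
    have h2 := hle hx 2
    generalize e - m (dist x (v 0)) = a₀ at *
    generalize e - m (dist x (v 1)) = a₁ at *
    generalize e - m (dist x (v 2)) = a₂ at *
    have hsq : (3 - 2 * κ * e) * e ^ 2 ≤ (3 - 2 * κ * e) * (a₀ * a₀ + a₁ * a₁ + a₂ * a₂) := by
      nlinarith [mul_nonneg hκ.le (sq_nonneg (a₀ + a₁ + a₂ - e))]
    have hsq' := le_of_mul_le_mul_left hsq (by linarith)
    have := mul_nonneg h0 h1
    have := mul_nonneg h0 h2
    have := mul_nonneg h1 h2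
    exact abs_le_of_sq_le_sq' (by nlinarith) (by linarith) |>.2
  rw [← h.m_dist_le_iff hDI]
  have hbox := box_inequality (hle hx 0) (hle hx 1) (hle hx 2) (hle hy 0) (hle hy 1) (hle hy 2)
    (hub x 0) (hub x 1) (hub x 2) (hub y 0) (hub y 1) (hub y 2) (hsum hy)
  have hid := identity x y
  have hprod : 0 ≤ (e - m (dist x (v 0))) * (e - m (dist y (v 0))) +
        (e - m (dist x (v 1))) * (e - m (dist y (v 1))) +
        (e - m (dist x (v 2))) * (e - m (dist y (v 2))) :=
    add_nonneg (add_nonneg (mul_nonneg (hle hx 0) (hle hy 0)) (mul_nonneg (hle hx 1) (hle hy 1)))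
      (mul_nonneg (hle hx 2) (hle hy 2))
  -- After the box inequality the sum of products keeps the factor `(3 - 2 * κ * e) - 2 * (1 - κ *
  -- e) = 1`.
  have hnn : 0 ≤ (3 - 2 * κ * e) * e * (e - m (dist x y)) := by
    rw [hid]
    nlinarith [mul_le_mul_of_nonneg_left hbox hκ.le]
  exact sub_nonneg.1 (nonneg_of_mul_nonneg_right hnn (mul_pos (by linarith) he))

end CosineLaw

theorem IsReuleauxTriangle.exists_vertices {X : Type*} [MetricSpace X] {D : ℝ} {U : Set X}
    (hU : IsReuleauxTriangle D U) (hD : 0 ≤ D) : ∃ v : Fin 3 → X,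
      (∀ i j, i ≠ j → dist (v i) (v j) = D) ∧ (∀ i, v i ∈ U) ∧
      ∀ x, x ∈ U ↔ ∀ i, dist x (v i) ≤ D := by
  obtain ⟨v, hv, rfl⟩ := hU
  refine ⟨v, hv, fun i => Set.mem_iInter.2 fun j => ?_, fun x => by simp⟩
  rcases eq_or_ne i j with rfl | hij
  · exact mem_closedBall_self hD
  · exact (hv i j hij).le

namespace CosineLaw

variable {X : Type*} [MetricSpace X] {κ : ℝ} {m s : ℝ → ℝ} {I : Set ℝ} {D : ℝ}

theorem diam_reuleaux (h : CosineLaw X κ m s I) (hI : Set.Icc 0 (2 * D) ⊆ I)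
    (hD : 0 < D) (hκ : 0 < 1 - κ * m D) {U : Set X} (hU : IsReuleauxTriangle D U) :
    IsDiametricallyComplete U ∧ diam U = D := by
  obtain ⟨v, hv, hvU, hmem⟩ := hU.exists_vertices hD.le
  have hle : ∀ x ∈ U, ∀ y ∈ U, dist x y ≤ D := fun x hx y hy =>
    h.dist_le_of_mem_reuleaux hI hD hκ hv ((hmem x).1 hx) ((hmem y).1 hy)
  have hbdd : Bornology.IsBounded U := isBounded_iff.2 ⟨D, hle⟩
  have hdiam : diam U = D := by
    refine le_antisymm (diam_le_of_forall_dist_le hD.le hle) ?_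
    rw [← hv 0 1 (by decide)]
    exact dist_le_diam_of_mem hbdd (hvU 0) (hvU 1)
  refine ⟨⟨hbdd, fun y hy => ?_⟩, hdiam⟩
  rw [hmem] at hy
  push Not at hy
  obtain ⟨i, hi⟩ := hy
  rw [hdiam]
  exact hi.trans_le (dist_le_diam_of_mem (hbdd.insert y) (Set.mem_insert _ _)
    (Set.mem_insert_of_mem _ (hvU i)))

theorem two_m_le_of_reuleaux_subset (h : CosineLaw X κ m s I) (hI : Set.Icc 0 (2 * D) ⊆ I)
    (hD : 0 < D) (hκ : 0 < 1 - κ * m D) {U : Set X} (hU : IsReuleauxTriangle D U) {z : X} {R : ℝ}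
    (hR0 : 0 ≤ R) (hRD : R ≤ D) (hz : U ⊆ closedBall z R) : 2 * m D ≤ 3 * s R ^ 2 := by
  obtain ⟨v, hv, hvU, -⟩ := hU.exists_vertices hD.le
  obtain ⟨p, hp⟩ := h.exists_chart z
  have hRI : R ∈ I := hI ⟨hR0, by linarith⟩
  have hle : ∀ i, m (dist z (v i)) ≤ m R := fun i => (h.m_dist_le_iff hRI).2 (by
    rw [dist_comm]
    exact hz (hvU i))
  have l01 := hp.law (v 0) (v 1)
  have l02 := hp.law (v 0) (v 2)
  have l12 := hp.law (v 1) (v 2)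
  rw [hv 0 1 (by decide)] at l01
  rw [hv 0 2 (by decide)] at l02
  rw [hv 1 2 (by decide)] at l12
  have n0 := h.norm_sq_chart hp (v 0)
  have n1 := h.norm_sq_chart hp (v 1)
  have n2 := h.norm_sq_chart hp (v 2)
  have hsum : 0 ≤ ‖p (v 0)‖ ^ 2 + ‖p (v 1)‖ ^ 2 + ‖p (v 2)‖ ^ 2 +
      2 * (inner ℝ (p (v 0)) (p (v 1)) + inner ℝ (p (v 0)) (p (v 2)) +
        inner ℝ (p (v 1)) (p (v 2))) := by
    have := sq_nonneg ‖p (v 0) + p (v 1) + p (v 2)‖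
    rw [norm_add_sq_real, norm_add_sq_real, inner_add_left] at this
    linarith
  have h0 := hle 0
  have h1 := hle 1
  have h2 := hle 2
  have hk := h.one_sub_pos hI hD hκ hR0 hRD
  rw [h.s_sq]
  have p0 := h.m_dist_nonneg z (v 0)
  have p1 := h.m_dist_nonneg z (v 1)
  have p2 := h.m_dist_nonneg z (v 2)
  generalize m (dist z (v 0)) = m₀ at *
  generalize m (dist z (v 1)) = m₁ at *
  generalize m (dist z (v 2)) = m₂ at *
  set σ := m₀ + m₁ + m₂ with hσ
  -- The three laws of cosines added up, with `hsum` eliminating the inner products. The right side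
  -- is then compared with its value `9 / 2 * s R ^ 2` at `σ = 3 * m R`.
  have hbound : 3 * m D ≤ 3 * σ - κ / 2 * σ ^ 2 := by
    rw [hσ]
    linarith
  have hσR : σ ≤ 3 * m R := by linarith
  have hκσ : 0 ≤ 6 - κ * (σ + 3 * m R) := by
    rcases le_total κ 0 with hk0 | hk0
    · have := h.m_nonneg hRI hR0
      nlinarith
    · nlinarith [mul_le_mul_of_nonneg_left hσR hk0]
  nlinarith [mul_nonneg (sub_nonneg.2 hσR) hκσ]

/-! ### Jung's theorem -/

theorem jung (h : CosineLaw X κ m s I) (hI : Set.Icc 0 (2 * D) ⊆ I) (hD : 0 < D)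
    [ProperSpace X] (hκ : 0 < 1 - κ * m D) {K : Set X} (hK : IsDiametricallyComplete K)
    (hd : diam K = D) : 3 * s (circumradius K) ^ 2 ≤ 2 * m D ∧
      (3 * s (circumradius K) ^ 2 = 2 * m D → IsReuleauxTriangle D K) := by
  have hne := nonempty_of_diam_pos hd hD
  obtain ⟨hmem, hleast⟩ := isLeast_circumradius hK.1 hne
  have hRD := hK.circumradius_le hd hD
  have hDI : D ∈ I := hI ⟨hD.le, by linarith⟩
  have he := h.m_pos hDI hD
  have hR0 := le_two_mul_of_mem_circumscribedRadii hd hmem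
  set R := circumradius K
  obtain ⟨-, z, hz⟩ := hmem
  obtain ⟨p, hp⟩ := h.exists_chart z
  have hcomp : IsCompact K := isCompact_of_isClosed_isBounded (hK.isClosed hd hD.le) hK.1
  obtain ⟨l, q, ⟨hl0, hl1⟩, hq, hzero⟩ := exists_three_of_mem_convexHull
    (h.zero_mem_convexHull_of_least hI hD hcomp hne (by linarith) hRD hz hleast hp)
  choose v hv hvq using hq
  have hinner : ∀ i j, inner ℝ (q i) (q j) = s R ^ 2 - m (dist (v i) (v j)) := fun i j => by
    rw [← hvq i, ← hvq j, h.s_sq]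
    have := hp.law (v i) (v j)
    rw [(hv i).2, (hv j).2] at this
    linarith
  have hself : ∀ i, inner ℝ (q i) (q i) = s R ^ 2 := fun i => by
    rw [hinner, dist_self, h.m_zero, sub_zero]
  have hm : ∀ i j, m (dist (v i) (v j)) ≤ m D := fun i j =>
    (h.m_dist_le_iff hDI).2 (hK.dist_le hd (hv i).1 (hv j).1)
  rw [Fin.sum_univ_three] at hl1 hzero
  have hexp : s R ^ 2 = 2 * (l 0 * l 1 * m (dist (v 0) (v 1)) + l 0 * l 2 * m (dist (v 0) (v 2)) +
      l 1 * l 2 * m (dist (v 1) (v 2))) := by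
    have hz2 : inner ℝ (l 0 • q 0 + l 1 • q 1 + l 2 • q 2) (l 0 • q 0 + l 1 • q 1 + l 2 • q 2)
        = (0 : ℝ) := by rw [hzero, inner_zero_left]
    simp only [inner_add_left, inner_add_right, real_inner_smul_left, real_inner_smul_right,
      hself, hinner 0 1, hinner 0 2, hinner 1 2, hinner 1 0, hinner 2 0, hinner 2 1,
      dist_comm (v 1) (v 0), dist_comm (v 2) (v 0), dist_comm (v 2) (v 1)] at hz2
    linear_combination hz2 - s R ^ 2 * (l 0 + l 1 + l 2 + 1) * hl1
  have p01 := mul_nonneg (hl0 0) (hl0 1)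
  have p02 := mul_nonneg (hl0 0) (hl0 2)
  have p12 := mul_nonneg (hl0 1) (hl0 2)
  have b01 := mul_le_mul_of_nonneg_left (hm 0 1) p01
  have b02 := mul_le_mul_of_nonneg_left (hm 0 2) p02
  have b12 := mul_le_mul_of_nonneg_left (hm 1 2) p12
  -- The deviation from equal weights is kept exactly, since it decides the equality case.
  have hsquare : 3 * (l 0 * l 1 + l 0 * l 2 + l 1 * l 2) =
      1 - ((l 0 - l 1) ^ 2 + (l 0 - l 2) ^ 2 + (l 1 - l 2) ^ 2) / 2 := by
    linear_combination (l 0 + l 1 + l 2 + 1) * hl1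
  have hvar : 0 ≤ m D * ((l 0 - l 1) ^ 2 + (l 0 - l 2) ^ 2 + (l 1 - l 2) ^ 2) := by positivity
  have hmul : m D * (3 * (l 0 * l 1 + l 0 * l 2 + l 1 * l 2)) = m D *
      (1 - ((l 0 - l 1) ^ 2 + (l 0 - l 2) ^ 2 + (l 1 - l 2) ^ 2) / 2) := by rw [hsquare]
  refine ⟨by linarith, fun heq => ?_⟩
  have hvar0 : (l 0 - l 1) ^ 2 + (l 0 - l 2) ^ 2 + (l 1 - l 2) ^ 2 = 0 := by
    have : m D * ((l 0 - l 1) ^ 2 + (l 0 - l 2) ^ 2 + (l 1 - l 2) ^ 2) = 0 := by linarith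
    exact (mul_eq_zero.1 this).resolve_left he.ne'
  have h01 : l 0 = l 1 := by
    have : (l 0 - l 1) ^ 2 = 0 := by
      nlinarith [sq_nonneg (l 0 - l 1), sq_nonneg (l 0 - l 2), sq_nonneg (l 1 - l 2)]
    exact sub_eq_zero.1 (pow_eq_zero_iff two_ne_zero |>.1 this)
  have h02 : l 0 = l 2 := by
    have : (l 0 - l 2) ^ 2 = 0 := by
      nlinarith [sq_nonneg (l 0 - l 1), sq_nonneg (l 0 - l 2), sq_nonneg (l 1 - l 2)]
    exact sub_eq_zero.1 (pow_eq_zero_iff two_ne_zero |>.1 this)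
  have l0 : l 0 = 1 / 3 := by linarith
  rw [← h01, ← h02, l0] at hexp
  have d01 : dist (v 0) (v 1) = D := h.dist_eq_of_m_eq hDI (by linarith [hm 0 1, hm 0 2, hm 1 2])
  have d02 : dist (v 0) (v 2) = D := h.dist_eq_of_m_eq hDI (by linarith [hm 0 1, hm 0 2, hm 1 2])
  have d12 : dist (v 1) (v 2) = D := h.dist_eq_of_m_eq hDI (by linarith [hm 0 1, hm 0 2, hm 1 2])
  have hreg := pairwise_dist_eq_of_three d01 d02 d12
  refine ⟨v, hreg, Set.Subset.antisymm ?_ ?_⟩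
  · exact Set.subset_iInter fun i x hx => hK.dist_le hd hx (hv i).1
  · intro x hx
    refine hK.mem_of_forall_dist_le hd hD.le fun y hy => ?_
    exact h.dist_le_of_mem_reuleaux hI hD hκ hreg (fun i => Set.mem_iInter.1 hx i)
      fun i => hK.dist_le hd hy (hv i).1

/-- `s b ^ 2 - s a ^ 2 = (m b - m a) * ((1 - κ * m a) + (1 - κ * m b))`. -/
theorem strictMonoOn_s_sq (h : CosineLaw X κ m s I) (hI : Set.Icc 0 (2 * D) ⊆ I)
    (hD : 0 < D) (hκ : 0 < 1 - κ * m D) : StrictMonoOn (fun t => s t ^ 2) (Set.Icc 0 D) := by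
  intro a ha b hb hab
  have hIa : a ∈ I := hI ⟨ha.1, by linarith [ha.2]⟩
  have hIb : b ∈ I := hI ⟨hb.1, by linarith [hb.2]⟩
  have hm := h.strictMonoOn hIa hIb hab
  have ka := h.one_sub_pos hI hD hκ ha.1 ha.2
  have kb := h.one_sub_pos hI hD hκ hb.1 hb.2
  simp only [h.s_sq]
  nlinarith [mul_pos (sub_pos.2 hm) (add_pos ka kb)]

theorem reuleaux_extremal [ProperSpace X] (h : CosineLaw X κ m s I)
    (hI : Set.Icc 0 (2 * D) ⊆ I) (hD : 0 < D) (hκ : 0 < 1 - κ * m D) :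
    (∃ U : Set X, IsReuleauxTriangle D U) ∧
    ∀ U : Set X, IsReuleauxTriangle D U →
    ∀ K : Set X, IsDiametricallyComplete K → diam K = D →
      (IsGreatest (inscribedRadii U) (inradius U) ∧
        IsLeast (circumscribedRadii U) (circumradius U) ∧
        IsGreatest (inscribedRadii K) (inradius K) ∧
        IsLeast (circumscribedRadii K) (circumradius K)) ∧
      (inradius U ≤ inradius K ∧ inradius K ≤ circumradius K ∧
        circumradius K ≤ circumradius U) ∧
      ((inradius U = inradius K ∨ circumradius K = circumradius U) →
        IsReuleauxTriangle D K) := by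
  refine ⟨?_, fun U hU K hK hd => ?_⟩
  · obtain ⟨v, hv⟩ := h.exists_regular_triangle hI hD hκ
    exact ⟨_, v, hv, rfl⟩
  obtain ⟨hUc, hUd⟩ := h.diam_reuleaux hI hD hκ hU
  have lU := isLeast_circumradius hUc.1 (nonempty_of_diam_pos hUd hD)
  have lK := isLeast_circumradius hK.1 (nonempty_of_diam_pos hd hD)
  have gU := h.isGreatest_inscribedRadii hI hD hUc hUd
  have gK := h.isGreatest_inscribedRadii hI hD hK hd
  rw [← h.inradius_eq hI hD hUc hUd] at gU
  rw [← h.inradius_eq hI hD hK hd] at gK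
  have bU := hUc.circumradius_le hUd hD
  have bK := hK.circumradius_le hd hD
  have jK := h.jung hI hD hκ hK hd
  have lower : 2 * m D ≤ 3 * s (circumradius U) ^ 2 := by
    obtain ⟨z, hz⟩ := lU.1.2
    exact h.two_m_le_of_reuleaux_subset hI hD hκ hU lU.1.1 bU hz
  have hmain : circumradius K ≤ circumradius U := by
    refine ((h.strictMonoOn_s_sq hI hD hκ).le_iff_le ⟨lK.1.1, bK⟩ ⟨lU.1.1, bU⟩).1 ?_
    linarith [jK.1]
  have hdiam := le_two_mul_of_mem_circumscribedRadii hd lK.1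
  refine ⟨⟨gU, lU, gK, lK⟩, ⟨?_, ?_, hmain⟩, fun heq => jK.2 (le_antisymm jK.1 ?_)⟩
  · rw [h.inradius_eq hI hD hUc hUd, h.inradius_eq hI hD hK hd]
    linarith
  · rw [h.inradius_eq hI hD hK hd]
    linarith
  · have : circumradius K = circumradius U := by
      rcases heq with heq | heq
      · rw [h.inradius_eq hI hD hUc hUd, h.inradius_eq hI hD hK hd] at heq
        linarith
      · exact heq
    rwa [this]

end CosineLaw

/-! ### The three model surfaces -/

theorem cosineLaw_euclidean : CosineLaw (EuclideanSpace ℝ (Fin 2)) 0 (fun t => t ^ 2 / 2)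
    (fun t => t) (Set.Ici 0) where
  dist_mem _ _ := dist_nonneg
  strictMonoOn a ha b _ hab := by
    have : 0 ≤ a := ha
    simp only
    nlinarith
  continuous_m := by fun_prop
  continuous_s := continuous_id
  m_zero := by norm_num
  s_nonneg _ ht := ht
  s_sq t := by ring
  m_add a b := by ring
  nonempty := inferInstance
  exists_chart z := by
    refine ⟨fun x => x - z, fun x y => ?_, fun t ht w hw => ⟨z + t • w, ?_, by simp⟩⟩
    · have : ‖x - y‖ ^ 2 = ‖(x - z) - (y - z)‖ ^ 2 := by rw [sub_sub_sub_cancel_right]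
      rw [norm_sub_sq_real (x - z)] at this
      rw [dist_eq_norm x y, this, dist_comm z x, dist_comm z y, dist_eq_norm, dist_eq_norm]
      ring
    · rw [dist_self_add_right, norm_smul, hw, mul_one, Real.norm_of_nonneg ht]

theorem UnitSphere.dist_eq (x y : UnitSphere) :
    dist x y = InnerProductGeometry.angle x.vec y.vec := rfl

theorem UnitSphere.cos_dist (x y : UnitSphere) : Real.cos (dist x y) = inner ℝ x.vec y.vec := by
  rw [UnitSphere.dist_eq, InnerProductGeometry.cos_angle, x.norm_vec, y.norm_vec]
  simp

/-- Supplies the properness needed for circumcentres: the chordal sphere maps continuously onto the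
geodesic one. -/
instance : CompactSpace UnitSphere := by
  let f : sphere (0 : EuclideanSpace ℝ (Fin 3)) 1 → UnitSphere :=
    fun x => ⟨x, by simp⟩
  have hf : Continuous f := by
    rw [continuous_iff_continuousAt]
    intro y
    rw [ContinuousAt, tendsto_iff_dist_tendsto_zero]
    have hcont : Continuous fun x => Real.arccos (inner ℝ (f x).vec (f y).vec) :=
      Real.continuous_arccos.comp (continuous_subtype_val.inner continuous_const)
    have heq : ∀ x, dist (f x) (f y) = Real.arccos (inner ℝ (f x).vec (f y).vec) := fun x => by
      rw [UnitSphere.dist_eq, InnerProductGeometry.angle, (f x).norm_vec, (f y).norm_vec]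
      simp
    have h0 : dist (f y) (f y) = 0 := dist_self _
    rw [heq] at h0
    simp_rw [heq]
    exact h0 ▸ hcont.tendsto y
  have hsurj : Function.Surjective f := fun x => ⟨⟨x.vec, by simpa using x.norm_vec⟩, rfl⟩
  exact hsurj.compactSpace hf

theorem nonempty_tangent_isometry (z : UnitSphere) :
    Nonempty ((Submodule.span ℝ {z.vec})ᗮ ≃ₗᵢ[ℝ] EuclideanSpace ℝ (Fin 2)) := by
  have : Fact (Module.finrank ℝ (EuclideanSpace ℝ (Fin 3)) = 2 + 1) := ⟨by simp⟩
  exact ⟨(OrthonormalBasis.fromOrthogonalSpanSingleton (𝕜 := ℝ) 2 z.vec_ne_zero).repr⟩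

theorem cosineLaw_spherical : CosineLaw UnitSphere 1 (fun t => 1 - Real.cos t) Real.sin
    (Set.Icc 0 Real.pi) where
  dist_mem _ _ := ⟨InnerProductGeometry.angle_nonneg _ _, InnerProductGeometry.angle_le_pi _ _⟩
  strictMonoOn a ha b hb hab := by
    have := Real.strictAntiOn_cos ha hb hab
    simp only
    linarith
  continuous_m := by fun_prop
  continuous_s := Real.continuous_sin
  m_zero := by simp
  s_nonneg _ ht := Real.sin_nonneg_of_mem_Icc ht
  s_sq t := by rw [Real.sin_sq]; ring
  m_add a b := by rw [Real.cos_add]; ring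
  nonempty := ⟨⟨EuclideanSpace.single 0 1, by simp⟩⟩
  exists_chart z := by
    obtain ⟨φ⟩ := nonempty_tangent_isometry z
    have hzz : inner ℝ z.vec z.vec = (1 : ℝ) := by
      rw [real_inner_self_eq_norm_sq, z.norm_vec, one_pow]
    have hmem : ∀ x : UnitSphere, x.vec - inner ℝ z.vec x.vec • z.vec ∈
        (Submodule.span ℝ {z.vec})ᗮ := fun x => by
      rw [Submodule.mem_orthogonal_singleton_iff_inner_right, inner_sub_right,
        real_inner_smul_right, hzz, mul_one, sub_self]
    -- The chart is the orthogonal projection to the tangent plane at `z`.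
    refine ⟨fun x => φ ⟨_, hmem x⟩, fun x y => ?_, fun t ht w hw => ?_⟩
    · rw [φ.inner_map_map, Submodule.coe_inner]
      simp only [UnitSphere.cos_dist, inner_sub_left, inner_sub_right, real_inner_smul_left,
        real_inner_smul_right, hzz, real_inner_comm z.vec x.vec]
      ring
    · have hu : inner ℝ z.vec (φ.symm w : EuclideanSpace ℝ (Fin 3)) = 0 :=
        Submodule.mem_orthogonal_singleton_iff_inner_right.1 (φ.symm w).2
      have huu : ‖(φ.symm w : EuclideanSpace ℝ (Fin 3))‖ = 1 := by
        rw [Submodule.norm_coe, φ.symm.norm_map, hw]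
      have hnorm : ‖Real.cos t • z.vec +
          Real.sin t • (φ.symm w : EuclideanSpace ℝ (Fin 3))‖ = 1 := by
        rw [← sq_eq_sq₀ (norm_nonneg _) zero_le_one, norm_add_sq_real, norm_smul, norm_smul,
          real_inner_smul_left, real_inner_smul_right, hu, huu, z.norm_vec]
        simp
      have hin : inner ℝ z.vec (Real.cos t • z.vec +
          Real.sin t • (φ.symm w : EuclideanSpace ℝ (Fin 3))) = Real.cos t := by
        rw [inner_add_right, real_inner_smul_right, real_inner_smul_right, hzz, hu]
        ring
      refine ⟨⟨_, hnorm⟩, ?_, ?_⟩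
      · rw [UnitSphere.dist_eq, InnerProductGeometry.angle, z.norm_vec, hnorm, hin]
        simpa using Real.arccos_cos ht.1 ht.2
      · rw [← φ.symm.injective.eq_iff, φ.symm_apply_apply, map_smul]
        ext1
        simp [hin]

theorem UpperHalfPlane.cosh_dist_re_im (x y : UpperHalfPlane) : Real.cosh (dist x y) =
    1 + ((x.re - y.re) ^ 2 + (x.im - y.im) ^ 2) / (2 * x.im * y.im) := by
  rw [UpperHalfPlane.cosh_dist, Complex.dist_eq_re_im, Real.sq_sqrt (by positivity)]
  rfl

theorem cosineLaw_hyperbolic : CosineLaw UpperHalfPlane (-1) (fun t => Real.cosh t - 1) Real.sinh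
    (Set.Ici 0) where
  dist_mem _ _ := dist_nonneg
  strictMonoOn a ha b hb hab := by
    have := Real.cosh_strictMonoOn ha hb hab
    simp only
    linarith
  continuous_m := by fun_prop
  continuous_s := Real.continuous_sinh
  m_zero := by simp
  s_nonneg _ ht := Real.sinh_nonneg_iff.2 ht
  s_sq t := by rw [Real.sinh_sq]; ring
  m_add a b := by rw [Real.cosh_add]; ring
  nonempty := ⟨UpperHalfPlane.I⟩
  exists_chart z := by
    have hz := z.im_pos
    -- These are the two spacelike coordinates in the hyperboloid model, after an isometry moving
    -- `z` to `i`.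
    refine ⟨fun x => !₂[(x.re - z.re) / x.im,
      ((x.re - z.re) ^ 2 + x.im ^ 2 - z.im ^ 2) / (2 * x.im * z.im)], fun x y => ?_,
      fun t ht w hw => ?_⟩
    · have hx := x.im_pos
      have hy := y.im_pos
      simp only [inner_plane, UpperHalfPlane.cosh_dist_re_im]
      simp only [Matrix.cons_val_zero, Matrix.cons_val_one]
      field_simp
      ring
    · have hw2 : w 0 ^ 2 + w 1 ^ 2 = 1 := by
        have := real_inner_self_eq_norm_sq w
        rw [hw, inner_plane] at this
        linarith
      have hcs := Real.cosh_sq t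
      have hlt : Real.sinh t < Real.cosh t := Real.sinh_lt_cosh t
      have hs0 : 0 ≤ Real.sinh t := Real.sinh_nonneg_iff.2 ht
      obtain ⟨C, hC⟩ : ∃ C, Real.cosh t = C := ⟨_, rfl⟩
      obtain ⟨S, hS⟩ : ∃ S, Real.sinh t = S := ⟨_, rfl⟩
      rw [hC, hS] at hcs hlt
      rw [hS] at hs0
      have hw1 : w 1 ≤ 1 := by nlinarith [sq_nonneg (w 0)]
      -- For the point sought, `cosh t` minus the second chart coordinate is `z.im / x.im`; this
      -- determines `x`.
      have hd : 0 < C - S * w 1 := by nlinarith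
      have hkey : (C - S * w 1) ^ 2 + 1 + (S * w 0) ^ 2 = 2 * C * (C - S * w 1) := by
        linear_combination hcs * (-1) + S ^ 2 * hw2
      obtain ⟨d, hd'⟩ : ∃ d, C - S * w 1 = d := ⟨_, rfl⟩
      rw [hd'] at hd hkey
      obtain ⟨x, hre, him⟩ : ∃ x : UpperHalfPlane, x.re = z.re + z.im * (S * w 0 / d) ∧
          x.im = z.im / d := ⟨⟨⟨_, z.im / d⟩, by positivity⟩, rfl, rfl⟩
      refine ⟨x, ?_, ?_⟩
      · have hcosh : Real.cosh (dist z x) = Real.cosh t := by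
          rw [UpperHalfPlane.cosh_dist_re_im, hre, him, hC]
          field_simp
          linear_combination z.im ^ 2 * hkey
        exact Real.cosh_strictMonoOn.injOn dist_nonneg ht hcosh
      · ext i
        rw [hS]
        fin_cases i
        · change (x.re - z.re) / x.im = S * w 0
          rw [hre, him]
          field_simp
          ring
        · change ((x.re - z.re) ^ 2 + x.im ^ 2 - z.im ^ 2) / (2 * x.im * z.im) = S * w 1
          rw [show S * w 1 = C - d by rw [← hd']; ring, hre, him]
          field_simp
          linear_combination z.im ^ 2 * hkey

theorem proposition6p1 (M : ModelSurface) (D : ℝ) (hD : 0 < D)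
    (hS : M = ModelSurface.spherical → D < Real.pi / 2) :
    (∃ U : Set M.Point, IsReuleauxTriangle D U) ∧
    ∀ U : Set M.Point, IsReuleauxTriangle D U →
    ∀ K : Set M.Point, IsDiametricallyComplete K → Metric.diam K = D →
      -- the extremal radii are attained
      (IsGreatest (inscribedRadii U) (inradius U) ∧
        IsLeast (circumscribedRadii U) (circumradius U) ∧
        IsGreatest (inscribedRadii K) (inradius K) ∧
        IsLeast (circumscribedRadii K) (circumradius K)) ∧
      -- the inequalities
      (inradius U ≤ inradius K ∧ inradius K ≤ circumradius K ∧
        circumradius K ≤ circumradius U) ∧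
      -- the cases of equality
      ((inradius U = inradius K ∨ circumradius K = circumradius U) →
        IsReuleauxTriangle D K) := by
  cases M with
  | euclidean =>
    exact cosineLaw_euclidean.reuleaux_extremal (fun t ht => ht.1) hD (by norm_num)
  | spherical =>
    have hDpi := hS rfl
    -- `D < π / 2` enters twice: `2 * D ≤ π` keeps prolonged segments in range, and `1 - κ * m D` is
    -- `cos D > 0`.
    refine cosineLaw_spherical.reuleaux_extremal (fun t ht => ⟨ht.1, by linarith [ht.2]⟩) hD ?_
    have := Real.cos_pos_of_mem_Ioo (x := D) ⟨by linarith, hDpi⟩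
    linarith
  | hyperbolic =>
    refine cosineLaw_hyperbolic.reuleaux_extremal (fun t ht => ht.1) hD ?_
    have := Real.cosh_pos D
    linarith
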